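/- **Conventions.** A premaniplex of rank $r$ is a finite connected graph, semi-edges allowed, whose edges are coloured by $0,\dots,r-1$, such that every vertex is on exactly one edge of each colour and, for $|i-j|>1$, the alternating paths of length 4 in the colours $i,j$ are closed. An edge that is not a semi-edge is a link. The $i$-faces are the connected components left after deleting the edges of colour $i$, and the facets are the faces of rank $r-1$. The closure $\overline f$ of a face $f$ is the set of facets that intersect it. For a vertex (flag) $\Phi$, $\Phi^i$ is its neighbour along colour $i$, and $r_i$ is the permutation $\Phi\mapsto\Phi^i$. Permutations of flags, and automorphisms (colour-preserving), act on the right. **The maniplexes $\mathcal M_n$.** Let $\mathcal M_2$ be the flag-graph of the square and, for $n\ge2$, $\mathcal M_{n+1}=\hat2^{\mathcal M_n}$. Here the flags of $\hat 2^{\mathcal M}$, for $\mathcal M$ of rank $n$, are the pairs $(\Phi,x)$ with $\Phi$ a flag of $\mathcal M$ and $x\in\mathbb Z_2^{\mathrm{Fac}(\mathcal M)}$, with $(\Phi,x)^i=(\Phi^i,x)$ for $i<n$ and $(\Phi,x)^n=(\Phi,x+\chi_F)$, where $F$ is the facet of $\Phi$ and $\chi_F$ its characteristic vector. The facets of $\hat2^{\mathcal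 M}$ correspond to the vectors $x$, and each is a copy of $\mathcal M$. All $\mathcal M_n$ are regular. **The sets $S_n$.** Let $S_3$ be any set of facets of $\mathcal M_3$ that is not invariant under any non-trivial automorphism and is not contained in $\overline u\cup\overline v$ for any 0-faces $u,v$. For $n\ge3$ let $S_{n+1}$ be the set of facets of $\mathcal M_{n+1}$ whose vector is $0$ or $\chi_F$ with $F\in S_n$. **The permutation $y_n$.** Let $n\ge4$, and let $e$ be any 1-face of $\mathcal M_{n-1}$. For $x\in\mathbb Z_2^{\mathrm{Fac}(\mathcal M_{n-1})}$, the base edge of the facet of $\mathcal M_n$ with vector $x$ is the edge $e\gamma$ of that copy of $\mathcal M_{n-1}$ if $\{F: x(F)=1\}=S_{n-1}\gamma$ for an automorphism $\gamma$ of $\mathcal M_{n-1}$, and it is $e$ if there is no such $\gamma$. Let $\tilde\rho_0$ be the permutation of the flags of $\mathcal M_n$ which acts on each facet as the automorphism of that facet that maps each flag on the base edge to its 0-adjacent flag. Put $y_n=\tilde\rho_0r_0$. **The voltages.** Let $\mathcal X=2^{n+1}_I$ be a premaniplex of rank $n+1$ with two vertices, in which the colours $0$ and $n$ are links ($I$ is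 the set of colours of semi-edges). Call one of the vertices white and the other black. Define the voltage $\xi(d)$ of a dart (directed edge) $d$ of colour $i$ by: $\xi(d)=1$ if $i=0$; $\xi(d)=y_n$ if $i=n$; and, if $1\le i\le n-1$, $\xi(d)=r_i$ for a semi-edge at the white vertex, $r_0r_ir_0$ for a semi-edge at the black vertex, $r_0r_i$ for a dart from white to black, and $r_ir_0$ for a dart from black to white. Put $\xi(d_1d_2\cdots d_s)=\xi(d_s)\cdots\xi(d_2)\xi(d_1)$ for a path $d_1d_2\cdots d_s$. Let $\Pi^{a,b}_{J}$ be the set of paths in $\mathcal X$ from $a$ to $b$ that only use colours in $J$, the empty path being included if $a=b$, and let $[k,m]=\{k,k+1,\dots,m\}$, which is empty if $k>m$. **Theorem.** For every $n\ge4$ and all choices as above, for every $k>1$, every $m\in[0,n]$ and every pair of vertices $a,b$ of $\mathcal X$, $$\xi(\Pi^{a,b}_{[0,m]})\cap\xi(\Pi^{a,b}_{[k,n]})=\xi(\Pi^{a,b}_{[k,m]}).$$ This holds for the voltages as permutations of all the flags of $\mathcal M_n$. It also holds for their restrictions to the set of white flags, for every covering $p$ from $\mathcal M_n$ to the premaniplex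 obtained from $\mathcal X$ by deleting the edges of colour $n$ (that is, every adjacency-preserving map $p$ on flags), where a flag is white if $p$ maps it to the white vertex. -/

import Mathlib

noncomputable section

namespace TwoOrbit

/-- A finite premaniplex of rank `n`: a finite connected graph, semi-edges allowed, with edges
coloured by `0, …, n-1`, each vertex being on exactly one edge of each colour, such that the
alternating paths of length 4 in two non-consecutive colours are closed.  `adj i v` is the other
end of the edge of colour `i` at `v`; that edge is a semi-edge when `adj i v = v` and a link
otherwise.  The flag-graph of a polytope, or any maniplex, is a premaniplex; its vertices are then
called flags. -/
structure Premaniplex (n : ℕ) where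
  V : Type
  finite : Finite V
  adj : Fin n → V → V
  adj_adj : ∀ i v, adj i (adj i v) = v
  alternating : ∀ i j : Fin n, ((i : ℕ) + 1 < j ∨ (j : ℕ) + 1 < i) →
    ∀ v, adj j (adj i (adj j (adj i v))) = v
  connected : ∀ u v, ∃ c : List (Fin n), c.foldl (fun w i => adj i w) u = v

namespace Premaniplex

variable {n : ℕ}

/-- The `i`-faces: the connected components after deleting the edges of colour `i`. -/
def Face (M : Premaniplex n) (i : Fin n) : Type :=
  Quot fun Φ Ψ : M.V => ∃ j, j ≠ i ∧ M.adj j Φ = Ψ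

/-- The `i`-face of a flag. -/
def face (M : Premaniplex n) (i : Fin n) (Φ : M.V) : M.Face i := Quot.mk _ Φ

/-- The facets: the faces of the greatest rank. -/
abbrev Facet (M : Premaniplex (n + 1)) : Type := M.Face (Fin.last n)

/-- The facet of a flag. -/
abbrev facet (M : Premaniplex (n + 1)) (Φ : M.V) : M.Facet := M.face (Fin.last n) Φ

/-- The closure of a face: the set of all facets incident to it. -/
def closure (M : Premaniplex (n + 1)) {i : Fin (n + 1)} (u : M.Face i) : Set M.Facet :=
  {F | ∃ Φ, M.face i Φ = u ∧ M.facet Φ = F}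

/-- The automorphism group: the colour-preserving graph automorphisms. -/
def Aut (M : Premaniplex n) : Subgroup (Equiv.Perm M.V) where
  carrier := {σ | ∀ i Φ, σ (M.adj i Φ) = M.adj i (σ Φ)}
  mul_mem' := by
    intro a b ha hb i Φ
    simp only [Set.mem_ofPred_eq] at ha hb
    simp [ha, hb]
  one_mem' := by intro i Φ; rfl
  inv_mem' := by
    intro a ha i Φ
    simp only [Set.mem_ofPred_eq] at ha
    rw [Equiv.Perm.inv_eq_iff_eq, ha]
    simp

/-- The action of an automorphism on the `i`-faces. -/
def onFace (M : Premaniplex n) (σ : M.Aut) (i : Fin n) : M.Face i → M.Face i :=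
  Quot.map σ.1 (by
    rintro Φ Ψ ⟨j, hj, rfl⟩
    exact ⟨j, hj, (σ.2 j Φ).symm⟩)

/-- A premaniplex is regular when its automorphism group is transitive on vertices. -/
def Regular (M : Premaniplex n) : Prop := ∀ Φ Ψ : M.V, ∃ σ : M.Aut, σ.1 Φ = Ψ

/-- The permutations of a set, acting on the right: `f * g` is "first `f`, then `g`". -/
abbrev RPerm (V : Type) : Type := (Equiv.Perm V)ᵐᵒᵖ

/-- The generator `r i` of the monodromy group, mapping each flag to its `i`-adjacent flag. -/
def r (M : Premaniplex n) (i : Fin n) : RPerm M.V :=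
  MulOpposite.op (Function.Involutive.toPerm (M.adj i) (M.adj_adj i))

/-! ### The construction `2̂^M` -/

open scoped Classical in
/-- The characteristic vector of a facet. -/
def chi (M : Premaniplex (n + 1)) (F : M.Facet) : M.Facet → ZMod 2 := Pi.single F 1

/-- The adjacencies of `2̂^M`. -/
def hatAdj (M : Premaniplex (n + 1)) (i : Fin (n + 2)) :
    M.V × (M.Facet → ZMod 2) → M.V × (M.Facet → ZMod 2) :=
  Fin.lastCases (fun p => (p.1, p.2 + M.chi (M.facet p.1)))
    (fun j p => (M.adj j p.1, p.2)) i

theorem hatAdj_last (M : Premaniplex (n + 1)) (p : M.V × (M.Facet → ZMod 2)) :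
    M.hatAdj (Fin.last (n + 1)) p = (p.1, p.2 + M.chi (M.facet p.1)) := by
  simp [hatAdj]

theorem hatAdj_castSucc (M : Premaniplex (n + 1)) (j : Fin (n + 1))
    (p : M.V × (M.Facet → ZMod 2)) :
    M.hatAdj j.castSucc p = (M.adj j p.1, p.2) := by
  simp [hatAdj]

theorem facet_adj (M : Premaniplex (n + 1)) {j : Fin (n + 1)} (hj : j ≠ Fin.last n) (Φ : M.V) :
    M.facet (M.adj j Φ) = M.facet Φ :=
  (Quot.sound ⟨j, hj, rfl⟩).symm

theorem add_self (M : Premaniplex (n + 1)) (x : M.Facet → ZMod 2) : x + x = 0 := by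
  funext F
  exact CharTwo.add_self_eq_zero (x F)

theorem hat_lift (M : Premaniplex (n + 1)) (c : List (Fin (n + 1)))
    (p : M.V × (M.Facet → ZMod 2)) :
    (c.map Fin.castSucc).foldl (fun w i => M.hatAdj i w) p =
      (c.foldl (fun w i => M.adj i w) p.1, p.2) := by
  induction c generalizing p with
  | nil => rfl
  | cons i c ih => simp only [List.map_cons, List.foldl_cons, hatAdj_castSucc, ih]

theorem hat_connected (M : Premaniplex (n + 1)) (p q : M.V × (M.Facet → ZMod 2)) :
    ∃ c : List (Fin (n + 2)), c.foldl (fun w i => M.hatAdj i w) p = q := by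
  classical
  have hfin : Finite M.Facet := by
    have := M.finite
    exact Quot.finite _
  have := Fintype.ofFinite M.Facet
  have key : ∀ (s : Finset M.Facet) (Φ Ψ : M.V) (x : M.Facet → ZMod 2),
      ∃ c : List (Fin (n + 2)), c.foldl (fun w i => M.hatAdj i w) (Φ, x) =
        (Ψ, x + ∑ F ∈ s, M.chi F) := by
    intro s
    induction s using Finset.induction_on with
    | empty =>
      intro Φ Ψ x
      obtain ⟨c, hc⟩ := M.connected Φ Ψ
      refine ⟨c.map Fin.castSucc, ?_⟩
      rw [hat_lift, hc]
      simp
    | insert F s hF ih =>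
      intro Φ Ψ x
      obtain ⟨Θ, hΘ⟩ := Quot.exists_rep F
      obtain ⟨c, hc⟩ := ih Φ Θ x
      obtain ⟨d, hd⟩ := M.connected Θ Ψ
      refine ⟨c ++ Fin.last (n + 1) :: d.map Fin.castSucc, ?_⟩
      have h : M.facet Θ = F := hΘ
      rw [List.foldl_append, hc, List.foldl_cons, hatAdj_last, hat_lift, hd,
        Finset.sum_insert hF, h, add_assoc, add_comm (M.chi F)]
  obtain ⟨c, hc⟩ := key (Finset.univ.filter fun F => (q.2 - p.2) F = 1) p.1 q.1 p.2
  refine ⟨c, hc.trans ?_⟩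
  have hs : ∑ F ∈ Finset.univ.filter (fun F => (q.2 - p.2) F = 1), M.chi F = q.2 - p.2 := by
    funext G
    rw [Finset.sum_apply]
    simp only [chi, Pi.single_apply]
    rw [Finset.sum_ite_eq]
    simp only [Finset.mem_filter, Finset.mem_univ, true_and]
    generalize (q.2 - p.2) G = z
    revert z
    decide
  rw [hs, add_sub_cancel]

/-- `2̂^M`, of rank one more than `M`: its flags are the pairs of a flag `Φ` of `M` and a vector
`x ∈ ℤ₂^Fac(M)`; the new colour adds to `x` the characteristic vector of the facet of `Φ`. -/
def hat2 (M : Premaniplex (n + 1)) : Premaniplex (n + 2) where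
  V := M.V × (M.Facet → ZMod 2)
  finite := by
    have := M.finite
    have : Finite M.Facet := Quot.finite _
    infer_instance
  adj := M.hatAdj
  adj_adj := by
    intro i p
    induction i using Fin.lastCases with
    | last => simp only [hatAdj_last, add_assoc, add_self, add_zero]
    | cast j => simp only [hatAdj_castSucc, M.adj_adj]
  alternating := by
    have hne : ∀ {j : Fin (n + 1)}, ((j : ℕ) + 1 < n + 1) → j ≠ Fin.last n := by
      intro j hj h
      rw [h] at hj
      simp at hj
    intro i j h p
    induction i using Fin.lastCases with
    | last =>
      induction j using Fin.lastCases with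
      | last => simp at h
      | cast j =>
        have hj : j ≠ Fin.last n := hne (by simp at h; omega)
        simp only [hatAdj_castSucc, hatAdj_last, M.facet_adj hj, M.adj_adj, add_assoc, add_self,
          add_zero]
    | cast i =>
      induction j using Fin.lastCases with
      | last =>
        have hi : i ≠ Fin.last n := hne (by simp at h; omega)
        simp only [hatAdj_castSucc, hatAdj_last, M.facet_adj hi, M.adj_adj, add_assoc, add_self,
          add_zero]
      | cast j =>
        simp only [hatAdj_castSucc]
        rw [M.alternating i j (by simpa using h)]
  connected := M.hat_connected

theorem onFace_face (M : Premaniplex n) (σ : M.Aut) (i : Fin n) (Φ : M.V) :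
    M.onFace σ i (M.face i Φ) = M.face i (σ.1 Φ) := rfl

theorem onFace_inv (M : Premaniplex n) (σ : M.Aut) (i : Fin n) (F : M.Face i) :
    M.onFace σ⁻¹ i (M.onFace σ i F) = F := by
  induction F using Quot.ind with
  | mk Φ => exact congrArg (Quot.mk _) (by simp)

theorem onFace_inv' (M : Premaniplex n) (σ : M.Aut) (i : Fin n) (F : M.Face i) :
    M.onFace σ i (M.onFace σ⁻¹ i F) = F := by
  induction F using Quot.ind with
  | mk Φ => exact congrArg (Quot.mk _) (by simp)

theorem hat2_regular (M : Premaniplex (n + 1)) (h : M.Regular) : M.hat2.Regular := by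
  classical
  rintro ⟨Φ, x⟩ ⟨Ψ, y⟩
  obtain ⟨σ, hσ⟩ := h Φ Ψ
  let c : M.Facet → ZMod 2 := y - x ∘ M.onFace σ⁻¹ (Fin.last n)
  let e : Equiv.Perm (M.V × (M.Facet → ZMod 2)) :=
    { toFun := fun p => (σ.1 p.1, p.2 ∘ M.onFace σ⁻¹ (Fin.last n) + c)
      invFun := fun p => (σ.1.symm p.1, (p.2 - c) ∘ M.onFace σ (Fin.last n))
      left_inv := by
        rintro ⟨ψ, z⟩
        refine Prod.ext (by simp) ?_
        funext F
        simp [onFace_inv]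
      right_inv := by
        rintro ⟨ψ, z⟩
        refine Prod.ext (by simp) ?_
        funext F
        simp [onFace_inv'] }
  have he : e ∈ M.hat2.Aut := by
    rintro i ⟨ψ, z⟩
    change e (M.hatAdj i (ψ, z)) = M.hatAdj i (e (ψ, z))
    induction i using Fin.lastCases with
    | last =>
      rw [hatAdj_last, hatAdj_last]
      refine Prod.ext rfl ?_
      funext F
      have hc : M.chi (M.facet ψ) (M.onFace σ⁻¹ (Fin.last n) F) = M.chi (M.facet (σ.1 ψ)) F := by
        simp only [chi, Pi.single_apply]
        refine if_congr ⟨fun hF => ?_, fun hF => ?_⟩ rfl rfl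
        · rw [← M.onFace_inv' σ _ F, hF]; rfl
        · rw [hF]; exact M.onFace_inv σ _ (M.facet ψ)
      change z _ + M.chi (M.facet ψ) (M.onFace σ⁻¹ (Fin.last n) F) + c F =
        z _ + c F + M.chi (M.facet (σ.1 ψ)) F
      rw [hc]; ring
    | cast j =>
      rw [hatAdj_castSucc, hatAdj_castSucc]
      exact Prod.ext (σ.2 j ψ) rfl
  refine ⟨⟨e, he⟩, Prod.ext hσ ?_⟩
  change x ∘ M.onFace σ⁻¹ (Fin.last n) + (y - x ∘ M.onFace σ⁻¹ (Fin.last n)) = y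
  exact add_sub_cancel _ _

/-! ### The family `M_n` -/

/-- The adjacencies in the flag-graph of the square with vertices `ℤ/4`. -/
def squareAdj (i : Fin 2) (p : ZMod 4 × Bool) : ZMod 4 × Bool :=
  if i = 0 then (if p.2 then (p.1 + 1, false) else (p.1 - 1, true)) else (p.1, !p.2)

/-- The flag-graph of the square with vertices `ℤ/4`: the flag `(a, true)` is the vertex `a` with
the edge `{a, a + 1}`, and `(a, false)` is the vertex `a` with the edge `{a, a - 1}`. -/
def square : Premaniplex 2 where
  V := ZMod 4 × Bool
  finite := by
    have : Finite (ZMod 4) := inferInstanceAs (Finite (Fin 4))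
    infer_instance
  adj := squareAdj
  adj_adj := by decide
  alternating := by decide
  connected := by
    have h : ∀ u v : ZMod 4 × Bool, ∃ k : Fin 5, ∃ b : Bool,
        (((if b then [0, 1, 0, 1] else [1, 0, 1, 0]).take k.1 : List (Fin 2)).foldl
          (fun w i => squareAdj i w) u = v) := by decide
    intro u v
    obtain ⟨k, b, hk⟩ := h u v
    exact ⟨_, hk⟩

theorem square_regular : square.Regular := by
  rintro ⟨a, s⟩ ⟨b, t⟩
  have h1 : ∀ (a t : ZMod 4) (s : Bool) (i : Fin 2),
      (((squareAdj i (a, s)).1 + t, (squareAdj i (a, s)).2) : ZMod 4 × Bool) =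
        squareAdj i (a + t, s) := by decide
  have h2 : ∀ (a t : ZMod 4) (s : Bool) (i : Fin 2),
      ((t - (squareAdj i (a, s)).1, !(squareAdj i (a, s)).2) : ZMod 4 × Bool) =
        squareAdj i (t - a, !s) := by decide
  by_cases hst : s = t
  · let e : Equiv.Perm (ZMod 4 × Bool) :=
      { toFun := fun p => (p.1 + (b - a), p.2)
        invFun := fun p => (p.1 - (b - a), p.2)
        left_inv := by rintro ⟨p, q⟩; simp
        right_inv := by rintro ⟨p, q⟩; simp }
    refine ⟨⟨e, ?_⟩, ?_⟩
    · rintro i ⟨p, q⟩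
      exact h1 p (b - a) q i
    · exact Prod.ext (add_sub_cancel a b) hst
  · let e : Equiv.Perm (ZMod 4 × Bool) :=
      { toFun := fun p => (a + b - p.1, !p.2)
        invFun := fun p => (a + b - p.1, !p.2)
        left_inv := by rintro ⟨p, q⟩; simp
        right_inv := by rintro ⟨p, q⟩; simp }
    refine ⟨⟨e, ?_⟩, ?_⟩
    · rintro i ⟨p, q⟩
      exact h2 p (a + b) q i
    · refine Prod.ext (add_sub_cancel_left a b) ?_
      change (!s) = t
      revert hst
      revert s t
      decide

/-- The maniplex `M_n` of rank `n = k + 2`: `M_2` is the flag-graph of the square and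
`M_{n+1} = 2̂^{M_n}`. -/
def M : (k : ℕ) → Premaniplex (k + 2)
  | 0 => square
  | k + 1 => (M k).hat2

theorem M_regular : ∀ k, (M k).Regular
  | 0 => square_regular
  | k + 1 => hat2_regular _ (M_regular k)

/-! ### The sets `S_n` -/

/-- The set of facets `Ŝ` of `2̂^M` given by a set `S` of facets of `M`: the facets whose vector is
zero or the characteristic vector of an element of `S`. -/
def hatS (M : Premaniplex (n + 1)) (S : Set M.Facet) : Set M.hat2.Facet :=
  {G | ∃ (Φ : M.V) (x : M.Facet → ZMod 2),
    (x = 0 ∨ ∃ F ∈ S, x = M.chi F) ∧ M.hat2.facet (Φ, x) = G}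

/-- What is required of the initial set `S_3` of facets of `M_3`: it is not invariant under any
non-trivial automorphism, and it is not contained in the union of the closures of two vertices. -/
def IsInitialSet (S : Set (M 1).Facet) : Prop :=
  (∀ γ : (M 1).Aut, (M 1).onFace γ (Fin.last 2) '' S = S → γ = 1) ∧
  ∀ u v : (M 1).Face 0, ¬ S ⊆ (M 1).closure u ∪ (M 1).closure v

/-- The set `S_n` of facets of `M_n`, `n = k + 3`, obtained from `S_3` by `S_{n+1} = Ŝ_n`. -/
def S (S₃ : Set (M 1).Facet) : (k : ℕ) → Set (M (k + 1)).Facet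
  | 0 => S₃
  | k + 1 => (M (k + 1)).hatS (S S₃ k)

/-! ### The permutations `ρ̃_0` and `y_n` of the flags of `2̂^M` -/

/-- The support of a vector. -/
def supp (M : Premaniplex (n + 1)) (x : M.Facet → ZMod 2) : Set M.Facet := {F | x F = 1}

open scoped Classical in
/-- A flag of `M` which, in the facet of `2̂^M` with vector `x`, lies on the base edge.  If `e` is
the edge of `φ`, then the base edge is `(eγ, x)` when `supp x` is a copy `Sγ` of `S`, with `γ` an
automorphism of `M`, and it is `(e, x)` when `supp x` is not a copy of `S`. -/
def baseFlag (M : Premaniplex (n + 1)) (S : Set M.Facet) (φ : M.V) (x : M.Facet → ZMod 2) : M.V :=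
  if h : ∃ γ : M.Aut, M.supp x = M.onFace γ (Fin.last n) '' S then h.choose.1 φ else φ

/-- The automorphism of a regular `M` that maps the flag `ψ` to its 0-adjacent flag, that is, the
reflection fixing all the faces of `ψ` but its 0-face. -/
def reflection (M : Premaniplex (n + 1)) (hM : M.Regular) (ψ : M.V) : M.Aut :=
  (hM ψ (M.adj 0 ψ)).choose

/-- The flag-permutation `ρ̃_0` of `2̂^M`: on the facet with vector `x`, a copy of `M`, it is the
reflection that fixes all the faces of the base flag of that facet but its 0-face.  It depends only
on the base edges. -/
def rhoTilde (M : Premaniplex (n + 1)) (hM : M.Regular) (S : Set M.Facet) (φ : M.V) :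
    RPerm M.hat2.V :=
  MulOpposite.op
    { toFun := fun p => ((M.reflection hM (M.baseFlag S φ p.2)).1 p.1, p.2)
      invFun := fun p => ((M.reflection hM (M.baseFlag S φ p.2)).1.symm p.1, p.2)
      left_inv := fun _ => Prod.ext (Equiv.symm_apply_apply _ _) rfl
      right_inv := fun _ => Prod.ext (Equiv.apply_symm_apply _ _) rfl }

/-- The voltage `y_n = ρ̃_0 r_0`. -/
def y (M : Premaniplex (n + 1)) (hM : M.Regular) (S : Set M.Facet) (φ : M.V) : RPerm M.hat2.V :=
  M.rhoTilde hM S φ * M.hat2.r 0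

/-! ### Voltages of paths -/

/-- The paths from one vertex of a premaniplex to another: the sequences of consecutive darts.
`cons v i W` is the dart of colour `i` starting at `v`, followed by the path `W`. -/
inductive Path (X : Premaniplex n) : X.V → X.V → Type
  | nil (v : X.V) : Path X v v
  | cons (v : X.V) (i : Fin n) {u : X.V} (W : Path X (X.adj i v) u) : Path X v u

/-- The colours of the darts of a path. -/
def Path.colors {X : Premaniplex n} : {a b : X.V} → X.Path a b → List (Fin n)
  | _, _, .nil _ => []
  | _, _, .cons _ i W => i :: W.colors

/-- The set `Π^{a,b}_I` of all paths from `a` to `b` that only use darts with colours in `I`. -/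
def pathsIn (X : Premaniplex n) (a b : X.V) (I : Set ℕ) : Set (X.Path a b) :=
  {W | ∀ c ∈ W.colors, (c : ℕ) ∈ I}

/-- The voltage `ξ(d_k) ⋯ ξ(d_2) ξ(d_1)` of the path `d_1 d_2 ⋯ d_k`, for a function `ξ` on darts,
a dart being given by its initial vertex and its colour. -/
def Path.voltage {X : Premaniplex n} {Γ : Type} [Group Γ] (ξ : X.V → Fin n → Γ) :
    {a b : X.V} → X.Path a b → Γ
  | _, _, .nil _ => 1
  | _, _, .cons v i W => W.voltage ξ * ξ v i

open scoped Classical in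
/-- The voltage `ξ` of the dart of colour `i` starting at `v`, with values in the permutations of
the flags of `2̂^N`; `w` is the white vertex of `X`. -/
def xi (N : Premaniplex (n + 1)) (hN : N.Regular) (S : Set N.Facet) (φ : N.V)
    (X : Premaniplex (n + 3)) (w v : X.V) (i : Fin (n + 3)) : RPerm N.hat2.V :=
  Fin.lastCases (N.y hN S φ)
    (fun j : Fin (n + 2) =>
      if j = 0 then 1
      else if X.adj j.castSucc v = v then
        (if v = w then N.hat2.r j else N.hat2.r 0 * N.hat2.r j * N.hat2.r 0)
      else
        (if v = w then N.hat2.r 0 * N.hat2.r j else N.hat2.r j * N.hat2.r 0)) i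

/-- The set `ξ(Π^{a,b}_I)` of the voltages of all the paths in `Π^{a,b}_I`. -/
def voltages (N : Premaniplex (n + 1)) (hN : N.Regular) (S : Set N.Facet) (φ : N.V)
    (X : Premaniplex (n + 3)) (w a b : X.V) (I : Set ℕ) : Set (RPerm N.hat2.V) :=
  Path.voltage (N.xi hN S φ X w) '' X.pathsIn a b I

/-- `p` is a covering from `M`, of rank `n`, to the premaniplex obtained from `X`, of rank `n + 1`,
by deleting the edges of colour `n`. -/
def IsCovering (M : Premaniplex n) (X : Premaniplex (n + 1)) (p : M.V → X.V) : Prop :=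
  ∀ i Φ, p (M.adj i Φ) = X.adj i.castSucc (p Φ)

/-- The restriction of a permutation of the flags of `M` to a set of flags. -/
def restrict (M : Premaniplex n) (A : Set M.V) (g : RPerm M.V) : A → M.V :=
  fun Φ => g.unop Φ

end Premaniplex

end TwoOrbit

end

/-! After a change of gauge by `r_0` at the black vertex, the voltage of a path is the word of its
colours, where a colour `i < n` acts as `r_i` and the colour `n` as `ρ̃_0` (`voltage_unop`). Suppose
that a word `c` in `[0, m]`, `m < n`, and a word `d` in `[k, n]` agree on a set `T` of flags that
meets every 0-adjacent pair. The set of all flags and the set of white flags are both of this kind.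

The word `d` avoids the colours 0 and 1. Started on the facet with vector 0, it only reaches flags
whose projections to `M_{n-1}` lie on one of two vertices, interchanged by the reflection `ρ` in the
base edge of that facet, and whose vectors are supported on the closures of these vertices (`Near`).
The set `S_{n-1}` does not fit into two such closures, a property inherited from `S_3`
(`Spread.hatS`). So none of these vectors is a copy of `S_{n-1}`, and `ρ̃_0` acts as the fixed
reflection `ρ` all the way.

On the base edge, `ρ` acts as `r_0`, so there `d` agrees with a word in 0 and `[k, n-1]`. By the
intersection property of `M_n` (`exists_act_inter`) and regularity, `c` equals everywhere a word in
0 and `[k, m]`. Since 0 commutes with the colours from 2 on, `c` is `z` or `z` followed by `r_0`,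
with `z` in `[k, m]`. The second case fails next to the base edge, at `(φ^1, 0)` or its 0-neighbour:
`c` leads there to a vertex that is neither the initial one nor its mirror image, as the projection
to the square shows. In the first case `z` and `c` have the same parities of colours
(`exists_potential`), so they have the same end in `X`. -/

noncomputable section

namespace TwoOrbit

namespace Premaniplex

variable {n : ℕ}

/-! ### Words acting on flags -/

/-- The action on flags of a word in the colours, the last letter acting first. -/
def act (M : Premaniplex n) (c : List (Fin n)) (Φ : M.V) : M.V := c.foldr M.adj Φ

theorem act_cons (M : Premaniplex n) (i : Fin n) (c : List (Fin n)) (Φ : M.V) :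
    M.act (i :: c) Φ = M.adj i (M.act c Φ) := rfl

theorem aut_act (M : Premaniplex n) (σ : M.Aut) (c : List (Fin n)) (Φ : M.V) :
    σ.1 (M.act c Φ) = M.act c (σ.1 Φ) := by
  induction c with
  | nil => rfl
  | cons i c ih => rw [act_cons, act_cons, ← ih]; exact σ.2 i _

theorem exists_act_eq (M : Premaniplex n) (Φ Ψ : M.V) : ∃ c, M.act c Φ = Ψ := by
  obtain ⟨c, hc⟩ := M.connected Φ Ψ
  refine ⟨c.reverse, ?_⟩
  rw [act, List.foldr_reverse]
  exact hc

/-- In a regular premaniplex, two words that agree on one flag agree on all flags. -/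
theorem Regular.act_eq {M : Premaniplex n} (hM : M.Regular) {c d : List (Fin n)} {Φ : M.V}
    (h : M.act c Φ = M.act d Φ) (Ψ : M.V) : M.act c Ψ = M.act d Ψ := by
  obtain ⟨σ, rfl⟩ := hM Φ Ψ
  rw [← aut_act, ← aut_act, h]

/-- Automorphisms that agree on one flag agree on all flags. -/
theorem aut_apply_eq (M : Premaniplex n) {σ τ : M.Aut} {Φ : M.V} (h : σ.1 Φ = τ.1 Φ) (Ψ : M.V) :
    σ.1 Ψ = τ.1 Ψ := by
  obtain ⟨c, rfl⟩ := M.exists_act_eq Φ Ψ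
  rw [aut_act, aut_act, h]

theorem adj_comm (M : Premaniplex n) {i j : Fin n} (h : (i : ℕ) + 1 < j ∨ (j : ℕ) + 1 < i)
    (Φ : M.V) : M.adj i (M.adj j Φ) = M.adj j (M.adj i Φ) := by
  have := congrArg (fun Ψ => M.adj i (M.adj j Ψ)) (M.alternating i j h Φ)
  simpa only [M.adj_adj] using this.symm

theorem face_adj (M : Premaniplex n) {i j : Fin n} (h : j ≠ i) (Φ : M.V) :
    M.face i (M.adj j Φ) = M.face i Φ :=
  (Quot.sound ⟨j, h, rfl⟩).symm

/-- The letter `0` commutes with all letters but `1`, so that it can be moved to the front. -/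
theorem exists_act_eq_of_ne_one (M : Premaniplex (n + 1)) (c : List (Fin (n + 1)))
    (hc : ∀ i ∈ c, (i : ℕ) ≠ 1) :
    ∃ z : List (Fin (n + 1)), (∀ i ∈ z, i ∈ c ∧ i ≠ 0) ∧
      ((∀ Φ, M.act c Φ = M.act z Φ) ∨ ∀ Φ, M.act c Φ = M.adj 0 (M.act z Φ)) := by
  induction c with
  | nil => exact ⟨[], by simp, Or.inl fun _ => rfl⟩
  | cons i c ih =>
    obtain ⟨z, hz, h⟩ := ih fun j hj => hc j (List.mem_cons_of_mem _ hj)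
    by_cases hi : i = 0
    · subst hi
      refine ⟨z, fun j hj => ⟨List.mem_cons_of_mem _ (hz j hj).1, (hz j hj).2⟩, ?_⟩
      rcases h with h | h
      · exact Or.inr fun Φ => by rw [act_cons, h]
      · exact Or.inl fun Φ => by rw [act_cons, h, M.adj_adj]
    · refine ⟨i :: z, ?_, ?_⟩
      · intro j hj
        rcases List.mem_cons.1 hj with rfl | hj
        · exact ⟨List.mem_cons_self, hi⟩
        · exact ⟨List.mem_cons_of_mem _ (hz j hj).1, (hz j hj).2⟩
      · have h1 := hc i List.mem_cons_self
        have h0 : (i : ℕ) ≠ 0 := fun h => hi (Fin.ext h)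
        rcases h with h | h
        · exact Or.inl fun Φ => by rw [act_cons, h, act_cons]
        · refine Or.inr fun Φ => ?_
          rw [act_cons, h, act_cons, M.adj_comm]
          right
          simp only [Fin.val_zero]
          omega

theorem face_zero_act (M : Premaniplex (n + 1)) (c : List (Fin (n + 1))) (hc : ∀ i ∈ c, i ≠ 0)
    (Φ : M.V) : M.face 0 (M.act c Φ) = M.face 0 Φ := by
  induction c with
  | nil => rfl
  | cons i c ih =>
    rw [act_cons, M.face_adj (hc i List.mem_cons_self)]
    exact ih fun j hj => hc j (List.mem_cons_of_mem _ hj)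

theorem adj_zero_act (M : Premaniplex (n + 1)) (c : List (Fin (n + 1)))
    (hc : ∀ i ∈ c, 2 ≤ (i : ℕ)) (Φ : M.V) : M.adj 0 (M.act c Φ) = M.act c (M.adj 0 Φ) := by
  induction c with
  | nil => rfl
  | cons i c ih =>
    rw [act_cons, act_cons, ← ih fun j hj => hc j (List.mem_cons_of_mem _ hj), M.adj_comm]
    left
    simp only [Fin.val_zero]
    exact hc i List.mem_cons_self

/-! ### Words acting on the flags of `2̂^M` -/

theorem hat2_adj_last (M : Premaniplex (n + 1)) (p : M.hat2.V) :
    M.hat2.adj (Fin.last (n + 1)) p = (p.1, p.2 + M.chi (M.facet p.1)) :=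
  M.hatAdj_last p

theorem hat2_adj_castSucc (M : Premaniplex (n + 1)) (j : Fin (n + 1)) (p : M.hat2.V) :
    M.hat2.adj j.castSucc p = (M.adj j p.1, p.2) :=
  M.hatAdj_castSucc j p

theorem hat2_adj_zero (M : Premaniplex (n + 1)) (p : M.hat2.V) :
    M.hat2.adj 0 p = (M.adj 0 p.1, p.2) :=
  M.hat2_adj_castSucc 0 p

theorem hat2_act_map (M : Premaniplex (n + 1)) (c : List (Fin (n + 1))) (p : M.hat2.V) :
    M.hat2.act (c.map Fin.castSucc) p = (M.act c p.1, p.2) := by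
  induction c with
  | nil => rfl
  | cons i c ih =>
    rw [List.map_cons, act_cons, ih]
    exact M.hat2_adj_castSucc i _

theorem exists_map_castSucc_eq (c : List (Fin (n + 1))) (hc : ∀ i ∈ c, i ≠ Fin.last n) :
    ∃ d : List (Fin n), d.map Fin.castSucc = c := by
  induction c with
  | nil => exact ⟨[], rfl⟩
  | cons i c ih =>
    obtain ⟨d, rfl⟩ := ih fun j hj => hc j (List.mem_cons_of_mem _ hj)
    obtain ⟨j, rfl⟩ := Fin.exists_castSucc_eq.2 (hc i List.mem_cons_self)
    exact ⟨j :: d, rfl⟩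

theorem exists_hat2_act_fst (M : Premaniplex (n + 1)) (c : List (Fin (n + 2))) :
    ∃ d : List (Fin (n + 1)), (∀ i ∈ d, i.castSucc ∈ c) ∧
      ∀ p, (M.hat2.act c p).1 = M.act d p.1 := by
  induction c with
  | nil => exact ⟨[], by simp, fun _ => rfl⟩
  | cons i c ih =>
    obtain ⟨d, hd, h⟩ := ih
    induction i using Fin.lastCases with
    | last =>
      refine ⟨d, fun j hj => List.mem_cons_of_mem _ (hd j hj), fun p => ?_⟩
      rw [act_cons, hat2_adj_last]
      exact h p
    | cast i =>
      refine ⟨i :: d, ?_, fun p => ?_⟩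
      · intro j hj
        rcases List.mem_cons.1 hj with rfl | hj
        · exact List.mem_cons_self
        · exact List.mem_cons_of_mem _ (hd j hj)
      · rw [act_cons, hat2_adj_castSucc, act_cons, ← h]

/-! ### The maniplexes `M_n` -/

/-- An instance of the intersection property: if a word with letters `≤ m` and a word with letters
in `J ∋ 0` agree on a flag, they agree there with a word whose letters satisfy both conditions. -/
theorem exists_act_inter (k m : ℕ) (J : Set ℕ) (hJ : 0 ∈ J) (c d : List (Fin (k + 2)))
    (hc : ∀ i ∈ c, (i : ℕ) ≤ m) (hd : ∀ i ∈ d, (i : ℕ) ∈ J) (Φ : (M k).V)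
    (h : (M k).act c Φ = (M k).act d Φ) :
    ∃ e : List (Fin (k + 2)), (∀ i ∈ e, (i : ℕ) ≤ m ∧ (i : ℕ) ∈ J) ∧
      (M k).act e Φ = (M k).act c Φ := by
  -- If `m` is at least the greatest colour, the bound by `m` is void and `d` itself serves.
  by_cases hm : k + 1 ≤ m
  · exact ⟨d, fun i hi => ⟨by omega, hd i hi⟩, h.symm⟩
  induction k with
  | zero =>
    refine ⟨c, fun i hi => ⟨hc i hi, ?_⟩, rfl⟩
    have := hc i hi
    rwa [show (i : ℕ) = 0 by omega]
  | succ k ih =>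
    -- The word `c` stays in one facet, a copy of the previous maniplex. Projecting `d` to that
    -- maniplex just drops its greatest colour.
    obtain ⟨c, rfl⟩ := exists_map_castSucc_eq c fun i hi h => by
      have := hc i hi
      rw [h, Fin.val_last] at this
      omega
    obtain ⟨d', hd', hdd⟩ := (M k).exists_hat2_act_fst d
    have hc' : ∀ i ∈ c, (i : ℕ) ≤ m := fun i hi => hc i.castSucc (List.mem_map_of_mem hi)
    have hJ' : ∀ i ∈ d', (i : ℕ) ∈ J := fun i hi => hd i.castSucc (hd' i hi)
    have hc1 : (M (k + 1)).act (c.map Fin.castSucc) Φ = ((M k).act c Φ.1, Φ.2) :=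
      (M k).hat2_act_map c Φ
    have h1 : (M k).act c Φ.1 = (M k).act d' Φ.1 := by
      rw [← hdd Φ]
      rw [hc1] at h
      exact congrArg Prod.fst h
    obtain ⟨e, he, hec⟩ : ∃ e : List (Fin (k + 2)), (∀ i ∈ e, (i : ℕ) ≤ m ∧ (i : ℕ) ∈ J) ∧
        (M k).act e Φ.1 = (M k).act c Φ.1 := by
      by_cases hkm : k + 1 ≤ m
      · exact ⟨d', fun i hi => ⟨by omega, hJ' i hi⟩, h1.symm⟩
      · exact ih c d' hc' hJ' Φ.1 h1 hkm
    refine ⟨e.map Fin.castSucc, ?_, ?_⟩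
    · intro i hi
      obtain ⟨j, hj, rfl⟩ := List.mem_map.1 hi
      exact he j hj
    · rw [hc1, ← hec]
      exact (M k).hat2_act_map e Φ

/-- The numbers of letters of each colour in a closed path of `M_n` are even: any assignment of
elements of `ℤ₂` to the colours comes from a potential. -/
theorem exists_potential (k : ℕ) (ε : Fin (k + 2) → ZMod 2) :
    ∃ p : (M k).V → ZMod 2, ∀ i Φ, p ((M k).adj i Φ) = p Φ + ε i := by
  induction k with
  | zero =>
    have key : ∃ f : ZMod 4 → ZMod 2, ∀ (e : Fin 2 → ZMod 2) (i : Fin 2) (p : ZMod 4 × Bool),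
        e 0 * f (squareAdj i p).1 +
            e 1 * (f (squareAdj i p).1 + if (squareAdj i p).2 then 1 else 0) =
          e 0 * f p.1 + e 1 * (f p.1 + if p.2 then 1 else 0) + e i :=
      -- The parity of the vertex counts the colour 0. Adding the Boolean, which both colours flip,
      -- gives a count of the colour 1.
      ⟨fun a => if a = 0 ∨ a = 2 then 0 else 1, by decide⟩
    obtain ⟨f, hf⟩ := key
    exact ⟨fun p : ZMod 4 × Bool => ε 0 * f p.1 + ε 1 * (f p.1 + if p.2 then 1 else 0), hf ε⟩
  | succ k ih =>
    have : Finite (M k).Facet := by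
      have := (M k).finite
      exact Quot.finite _
    have := Fintype.ofFinite (M k).Facet
    obtain ⟨p, hp⟩ := ih fun i => ε i.castSucc
    -- The new colour changes exactly one coordinate of the vector, so the coordinate sum counts it.
    let p' : (M k).hat2.V → ZMod 2 := fun q => p q.1 + ε (Fin.last _) * ∑ F, q.2 F
    suffices h : ∀ i Φ, p' ((M k).hat2.adj i Φ) = p' Φ + ε i from ⟨p', h⟩
    intro i Φ
    simp only [p']
    induction i using Fin.lastCases with
    | last =>
      rw [hat2_adj_last]
      have : ∑ F, (M k).chi ((M k).facet Φ.1) F = 1 := by simp [chi]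
      simp only [Pi.add_apply, Finset.sum_add_distrib, this]
      ring
    | cast i =>
      rw [hat2_adj_castSucc, hp]
      ring

theorem potential_act {M : Premaniplex n} {ε : Fin n → ZMod 2} {p : M.V → ZMod 2}
    (hp : ∀ i Φ, p (M.adj i Φ) = p Φ + ε i) (c : List (Fin n)) (Φ : M.V) :
    p (M.act c Φ) = p Φ + (c.map ε).sum := by
  induction c with
  | nil => simp [act]
  | cons i c ih => rw [act_cons, hp, ih, List.map_cons, List.sum_cons]; ring

/-- The projection of the flags of `M_n` to the flags of the square. -/
def toSquare : (k : ℕ) → (M k).V → ZMod 4 × Bool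
  | 0 => id
  | k + 1 => fun p => toSquare k p.1

theorem toSquare_adj (k : ℕ) (i : Fin (k + 2)) (Φ : (M k).V) :
    toSquare k ((M k).adj i Φ) =
      if h : (i : ℕ) < 2 then squareAdj ⟨i, h⟩ (toSquare k Φ) else toSquare k Φ := by
  induction k with
  | zero => rw [dif_pos i.2]; rfl
  | succ k ih =>
    revert Φ
    change ∀ Φ : (M k).hat2.V, toSquare k ((M k).hat2.adj i Φ).1 =
      if h : (i : ℕ) < 2 then squareAdj ⟨i, h⟩ (toSquare k Φ.1) else toSquare k Φ.1
    intro Φ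
    induction i using Fin.lastCases with
    | last => rw [hat2_adj_last, dif_neg (by simp)]
    | cast i => rw [hat2_adj_castSucc]; exact ih i Φ.1

theorem toSquare_adj_zero (k : ℕ) (Φ : (M k).V) :
    toSquare k ((M k).adj 0 Φ) = squareAdj 0 (toSquare k Φ) := by
  rw [toSquare_adj, dif_pos (by simp)]; rfl

theorem toSquare_adj_one (k : ℕ) (Φ : (M k).V) :
    toSquare k ((M k).adj 1 Φ) = squareAdj 1 (toSquare k Φ) := by
  rw [toSquare_adj, dif_pos (by simp)]; rfl

/-- Only the colour 0 moves the vertex of the square, so vertices of `M_n` can be told apart there.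
-/
theorem toSquare_fst_eq (k : ℕ) {Φ Ψ : (M k).V} (h : (M k).face 0 Φ = (M k).face 0 Ψ) :
    (toSquare k Φ).1 = (toSquare k Ψ).1 := by
  have hs : ∀ p, (squareAdj 1 p).1 = p.1 := by decide
  refine congrArg (Quot.lift (fun Φ => (toSquare k Φ).1) ?_) h
  rintro Φ _ ⟨j, hj, rfl⟩
  rw [toSquare_adj]
  split_ifs with h2
  · have h0 : (j : ℕ) ≠ 0 := fun h => hj (Fin.ext h)
    have : (⟨j, h2⟩ : Fin 2) = 1 := Fin.ext (by simp; omega)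
    rw [this, hs]
  · rfl

/-! ### The sets `S_n` -/

theorem hat2_facet_inj (M : Premaniplex (n + 1)) {p q : M.hat2.V}
    (h : M.hat2.facet p = M.hat2.facet q) : p.2 = q.2 := by
  refine congrArg (Quot.lift (fun p : M.hat2.V => p.2) ?_) h
  rintro p _ ⟨j, hj, rfl⟩
  obtain ⟨j, rfl⟩ := Fin.exists_castSucc_eq.2 hj
  rw [hat2_adj_castSucc]

theorem facet_mem_closure (M : Premaniplex (n + 1)) {i : Fin (n + 1)} (Φ : M.V) :
    M.facet Φ ∈ M.closure (M.face i Φ) := ⟨Φ, rfl, rfl⟩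

theorem chi_self (M : Premaniplex (n + 1)) (F : M.Facet) : M.chi F F = 1 := by
  classical exact Pi.single_eq_same _ _

theorem chi_of_ne (M : Premaniplex (n + 1)) {F G : M.Facet} (h : G ≠ F) : M.chi F G = 0 := by
  classical exact Pi.single_eq_of_ne h _

/-- The vectors of two facets of `2̂^M` on a common vertex `u` agree outside the closure of the
projection of `u` to `M`. -/
theorem hat2_face_zero (M : Premaniplex (n + 1)) {p q : M.hat2.V}
    (h : M.hat2.face 0 p = M.hat2.face 0 q) {F : M.Facet} (hF : F ∉ M.closure (M.face 0 q.1)) :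
    p.2 F = q.2 F := by
  classical
  -- An invariant of all colours but 0: the new colour can change the coordinate `F` only at a flag
  -- of `F`, where this coordinate is masked.
  let f : M.hat2.V → M.Face 0 × ZMod 2 :=
    fun p => (M.face 0 p.1, if F ∈ M.closure (M.face 0 p.1) then 0 else p.2 F)
  have hf : f p = f q := by
    refine congrArg (Quot.lift f ?_) h
    rintro p _ ⟨j, hj, rfl⟩
    induction j using Fin.lastCases with
    | last =>
      rw [hat2_adj_last]
      refine Prod.ext rfl ?_
      change (if _ then _ else _) = (if F ∈ M.closure (M.face 0 p.1) then _ else _)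
      split_ifs with hFp
      · rfl
      · have : F ≠ M.facet p.1 := fun h => hFp (h ▸ M.facet_mem_closure p.1)
        simp [M.chi_of_ne this]
    | cast j =>
      have hj0 : j ≠ 0 := by rintro rfl; exact hj rfl
      rw [hat2_adj_castSucc]
      simp only [f, M.face_adj hj0]
  have h1 : M.face 0 p.1 = M.face 0 q.1 := congrArg Prod.fst hf
  have h2 := congrArg Prod.snd hf
  simpa only [f, h1, if_neg hF] using h2

/-- A set of facets is spread if it is not contained in the union of the closures of two
vertices. -/
def Spread (M : Premaniplex (n + 1)) (S : Set M.Facet) : Prop :=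
  ∀ u v : M.Face 0, ¬ S ⊆ M.closure u ∪ M.closure v

/-- One of the two vertices carries the facet with vector 0, so it carries no `χ_F` with `F ∈ S`
outside the closure of its projection. The other vertex must carry all those `χ_F`, whose vectors
then agree outside the closure of its own projection. Two suitable elements of `S` contradict this.
-/
theorem Spread.hatS {M : Premaniplex (n + 1)} {S : Set M.Facet} (hS : M.Spread S) :
    M.hat2.Spread (M.hatS S) := by
  have key : ∀ (p q : M.hat2.V), M.hat2.facet (p.1, 0) ∈ M.hat2.closure (M.hat2.face 0 p) →
      ¬ M.hatS S ⊆ M.hat2.closure (M.hat2.face 0 p) ∪ M.hat2.closure (M.hat2.face 0 q) := by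
    intro p q h0 hsub
    have hcl : ∀ (s : M.hat2.V) (Φ : M.V) (x : M.Facet → ZMod 2),
        M.hat2.facet (Φ, x) ∈ M.hat2.closure (M.hat2.face 0 s) →
        ∀ F ∉ M.closure (M.face 0 s.1), x F = s.2 F := by
      rintro s Φ x ⟨t, ht, htf⟩ F hF
      have h1 : t.2 = x := M.hat2_facet_inj htf
      rw [← h1]
      exact M.hat2_face_zero ht hF
    have hp0 := hcl p _ _ h0
    have hq : ∀ F ∈ S, F ∉ M.closure (M.face 0 p.1) →
        ∀ G ∉ M.closure (M.face 0 q.1), M.chi F G = q.2 G := by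
      intro F hF hFp
      rcases hsub ⟨p.1, M.chi F, Or.inr ⟨F, hF, rfl⟩, rfl⟩ with h | h
      · have h1 := hcl p _ _ h F hFp
        rw [← hp0 F hFp, chi_self] at h1
        exact absurd h1 one_ne_zero
      · exact hcl q _ _ h
    obtain ⟨F, hF, hFn⟩ := Set.not_subset.1 (hS (M.face 0 p.1) (M.face 0 q.1))
    rw [Set.mem_union, not_or] at hFn
    obtain ⟨Φ, hΦ⟩ := Quot.exists_rep F
    -- Spreadness is used again with a vertex of `F`, which forces `G ≠ F`. Then `χ_F` and `χ_G`
    -- would have to agree at `F`.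
    obtain ⟨G, hG, hGn⟩ := Set.not_subset.1 (hS (M.face 0 p.1) (M.face 0 Φ))
    rw [Set.mem_union, not_or] at hGn
    have hFG : F ≠ G := by
      rintro rfl
      apply hGn.2
      have := M.facet_mem_closure (i := 0) Φ
      rwa [show M.facet Φ = F from hΦ] at this
    have h1 := hq F hF hFn.1 F hFn.2
    rw [← hq G hG hGn.1 F hFn.2, chi_self, M.chi_of_ne hFG] at h1
    exact one_ne_zero h1
  intro u v
  obtain ⟨p, rfl⟩ := Quot.exists_rep u
  obtain ⟨q, rfl⟩ := Quot.exists_rep v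
  intro hsub
  -- The facet with vector 0 does not depend on the flag chosen, so the two vertices play symmetric
  -- roles.
  have hz : ∀ Φ Ψ : M.V, M.hat2.facet (Φ, 0) = M.hat2.facet (Ψ, 0) := by
    intro Φ Ψ
    obtain ⟨c, rfl⟩ := M.exists_act_eq Φ Ψ
    induction c with
    | nil => rfl
    | cons i c ih =>
      rw [ih, act_cons]
      exact Quot.sound ⟨i.castSucc, (Fin.castSucc_lt_last i).ne, M.hat2_adj_castSucc i _⟩
  rcases hsub ⟨p.1, 0, Or.inl rfl, rfl⟩ with h | h
  · exact key p q h hsub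
  · rw [hz p.1 q.1] at h
    rw [Set.union_comm] at hsub
    exact key q p h hsub

theorem spread_S {S₃ : Set (M 1).Facet} (h : IsInitialSet S₃) : ∀ k, (M (k + 1)).Spread (S S₃ k)
  | 0 => h.2
  | k + 1 => (spread_S h k).hatS

/-- The base flag is `φ` when the support of the vector is covered by two vertices. -/
theorem Spread.baseFlag_eq {M : Premaniplex (n + 1)} {S : Set M.Facet} (hS : M.Spread S) (φ : M.V)
    {x : M.Facet → ZMod 2} {u v : M.Face 0}
    (hx : ∀ F, x F ≠ 0 → F ∈ M.closure u ∪ M.closure v) : M.baseFlag S φ x = φ := by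
  rw [baseFlag, dif_neg]
  rintro ⟨γ, hγ⟩
  have hcl : ∀ (w : M.Face 0) (F : M.Facet), M.onFace γ _ F ∈ M.closure w →
      F ∈ M.closure (M.onFace γ⁻¹ 0 w) := by
    rintro w F ⟨Φ, rfl, hΦ⟩
    refine ⟨γ⁻¹.1 Φ, rfl, ?_⟩
    rw [← M.onFace_inv γ _ F, ← hΦ]
    rfl
  refine hS (M.onFace γ⁻¹ 0 u) (M.onFace γ⁻¹ 0 v) fun F hF => ?_
  have h1 : x (M.onFace γ _ F) = 1 := by
    have : M.onFace γ _ F ∈ M.supp x := hγ ▸ Set.mem_image_of_mem _ hF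
    exact this
  exact (hx _ (h1 ▸ one_ne_zero)).imp (hcl u F) (hcl v F)

/-! ### Words in the colours of the flags and in `ρ̃_0` -/

theorem reflection_apply_self (M : Premaniplex n.succ) (hM : M.Regular) (ψ : M.V) :
    (M.reflection hM ψ).1 ψ = M.adj 0 ψ := (hM ψ (M.adj 0 ψ)).choose_spec

theorem reflection_reflection (M : Premaniplex (n + 1)) (hM : M.Regular) (ψ Φ : M.V) :
    (M.reflection hM ψ).1 ((M.reflection hM ψ).1 Φ) = Φ := by
  refine M.aut_apply_eq (σ := M.reflection hM ψ * M.reflection hM ψ) (τ := 1) (Φ := ψ) ?_ Φ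
  change (M.reflection hM ψ).1 ((M.reflection hM ψ).1 ψ) = ψ
  rw [reflection_apply_self, (M.reflection hM ψ).2, reflection_apply_self, M.adj_adj]

/-- The action on the flags of `2̂^N` of the colours, the greatest colour acting as `ρ̃_0`. -/
def extAdj (N : Premaniplex (n + 1)) (hN : N.Regular) (S : Set N.Facet) (φ : N.V)
    (i : Fin (n + 3)) : N.hat2.V → N.hat2.V :=
  Fin.lastCases (N.rhoTilde hN S φ).unop (fun j => N.hat2.adj j) i

theorem extAdj_last (N : Premaniplex (n + 1)) (hN : N.Regular) (S : Set N.Facet) (φ : N.V)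
    (p : N.hat2.V) : N.extAdj hN S φ (Fin.last (n + 2)) p =
      ((N.reflection hN (N.baseFlag S φ p.2)).1 p.1, p.2) := by
  rw [extAdj, Fin.lastCases_last]; rfl

theorem extAdj_castSucc (N : Premaniplex (n + 1)) (hN : N.Regular) (S : Set N.Facet) (φ : N.V)
    (j : Fin (n + 2)) (p : N.hat2.V) : N.extAdj hN S φ j.castSucc p = N.hat2.adj j p := by
  rw [extAdj, Fin.lastCases_castSucc]

/-- The action of a word, the last letter acting first. -/
def extAct (N : Premaniplex (n + 1)) (hN : N.Regular) (S : Set N.Facet) (φ : N.V)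
    (c : List (Fin (n + 3))) (p : N.hat2.V) : N.hat2.V := c.foldr (N.extAdj hN S φ) p

theorem extAct_map (N : Premaniplex (n + 1)) (hN : N.Regular) (S : Set N.Facet) (φ : N.V)
    (c : List (Fin (n + 2))) (p : N.hat2.V) :
    N.extAct hN S φ (c.map Fin.castSucc) p = N.hat2.act c p := by
  induction c with
  | nil => rfl
  | cons i c ih =>
    rw [List.map_cons, act_cons, ← ih, ← N.extAdj_castSucc hN S φ]
    rfl

theorem extAdj_last_adj_zero (N : Premaniplex (n + 1)) (hN : N.Regular) (S : Set N.Facet)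
    (φ : N.V) (p : N.hat2.V) :
    N.extAdj hN S φ (Fin.last (n + 2)) (N.hat2.adj 0 p) =
      N.hat2.adj 0 (N.extAdj hN S φ (Fin.last (n + 2)) p) := by
  rw [extAdj_last, hat2_adj_zero, hat2_adj_zero, extAdj_last]
  exact Prod.ext ((N.reflection hN (N.baseFlag S φ p.2)).2 0 p.1) rfl

section Tracking

variable (N : Premaniplex (n + 1)) (hN : N.Regular) {S : Set N.Facet} (φ : N.V)

/-- The flags of `2̂^N` that can be reached from `(ψ, 0)` by words without the letters `0, 1`, as
described by their vertices and vectors. -/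
structure Near (ψ : N.V) (p : N.hat2.V) : Prop where
  supp : ∀ F, p.2 F ≠ 0 →
    F ∈ N.closure (N.face 0 ψ) ∪ N.closure (N.face 0 ((N.reflection hN φ).1 ψ))
  vertex : N.face 0 p.1 = N.face 0 ψ ∨ N.face 0 p.1 = N.face 0 ((N.reflection hN φ).1 ψ)

variable {N hN φ}

theorem Near.extAdj_last_eq (hS : N.Spread S) {ψ : N.V} {p : N.hat2.V}
    (h : N.Near hN φ ψ p) :
    N.extAdj hN S φ (Fin.last (n + 2)) p = ((N.reflection hN φ).1 p.1, p.2) := by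
  rw [extAdj_last, hS.baseFlag_eq φ h.supp]

/-- The letter `ρ̃_0` swaps the two vertices, being the reflection of `φ` here. The greatest colour
of `2̂^N` alters the vector only at a facet on the current vertex, and the colours from 2 below it
change neither vertex nor vector. -/
theorem Near.extAdj (hS : N.Spread S) {ψ : N.V} {p : N.hat2.V} (h : N.Near hN φ ψ p)
    {i : Fin (n + 3)} (hi : 2 ≤ (i : ℕ)) : N.Near hN φ ψ (N.extAdj hN S φ i p) := by
  induction i using Fin.lastCases with
  | last =>
    rw [h.extAdj_last_eq hS]
    refine ⟨h.supp, h.vertex.symm.imp (fun hv => ?_) fun hv => ?_⟩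
    · change N.face 0 ((N.reflection hN φ).1 p.1) = _
      rw [← onFace_face, hv, onFace_face, reflection_reflection]
    · change N.face 0 ((N.reflection hN φ).1 p.1) = _
      rw [← onFace_face, hv, onFace_face]
  | cast i =>
    rw [extAdj_castSucc]
    induction i using Fin.lastCases with
    | last =>
      rw [hat2_adj_last]
      refine ⟨fun F hF => ?_, h.vertex⟩
      by_cases hFp : F = N.facet p.1
      · rw [hFp]
        have := N.facet_mem_closure (i := 0) p.1
        rcases h.vertex with hv | hv
        · exact Or.inl (hv ▸ this)
        · exact Or.inr (hv ▸ this)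
      · apply h.supp
        simpa [N.chi_of_ne hFp] using hF
    | cast i =>
      rw [hat2_adj_castSucc]
      refine ⟨h.supp, ?_⟩
      rw [N.face_adj]
      · exact h.vertex
      · rintro rfl
        simp at hi

theorem near_self {p : N.hat2.V} (hp : p.2 = 0) : N.Near hN φ p.1 p :=
  ⟨fun F hF => absurd (congrFun hp F) hF, Or.inl rfl⟩

theorem Near.extAct (hS : N.Spread S) {ψ : N.V} {p : N.hat2.V} (h : N.Near hN φ ψ p)
    (c : List (Fin (n + 3))) (hc : ∀ i ∈ c, 2 ≤ (i : ℕ)) :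
    N.Near hN φ ψ (N.extAct hN S φ c p) := by
  induction c with
  | nil => exact h
  | cons i c ih =>
    exact (ih fun j hj => hc j (List.mem_cons_of_mem _ hj)).extAdj hS (hc i List.mem_cons_self)

/-- On the facet with vector `0`, at the base edge, `ρ̃_0` can be replaced by `r_0`. -/
theorem exists_extAct_eq_act (hS : N.Spread S) {p : N.hat2.V} (hp : p.2 = 0)
    (hφ : (N.reflection hN φ).1 p.1 = N.adj 0 p.1) (c : List (Fin (n + 3)))
    (hc : ∀ i ∈ c, 2 ≤ (i : ℕ)) :
    ∃ d : List (Fin (n + 2)), (∀ i ∈ d, i = 0 ∨ i.castSucc ∈ c) ∧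
      N.extAct hN S φ c p = N.hat2.act d p ∧
      (N.reflection hN φ).1 (N.hat2.act d p).1 = N.adj 0 (N.hat2.act d p).1 := by
  induction c with
  | nil => exact ⟨[], by simp, rfl, hφ⟩
  | cons i c ih =>
    have hc' : ∀ j ∈ c, 2 ≤ (j : ℕ) := fun j hj => hc j (List.mem_cons_of_mem _ hj)
    obtain ⟨d, hd, hcd, hr⟩ := ih hc'
    have hnear := (near_self (hN := hN) (φ := φ) hp).extAct hS c hc'
    have hstep : N.extAct hN S φ (i :: c) p =
      N.extAdj hN S φ i (N.extAct hN S φ c p) := rfl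
    rw [hstep]
    have hi := hc i List.mem_cons_self
    induction i using Fin.lastCases with
    | last =>
      refine ⟨0 :: d, ?_, ?_, ?_⟩
      · intro j hj
        rcases List.mem_cons.1 hj with rfl | hj
        · exact Or.inl rfl
        · exact (hd j hj).imp_right (List.mem_cons_of_mem _)
      · rw [hnear.extAdj_last_eq hS, hcd, hr, act_cons, hat2_adj_zero]
      · rw [act_cons, hat2_adj_zero]
        change (N.reflection hN φ).1 (N.adj 0 _) = N.adj 0 (N.adj 0 _)
        rw [← hr, reflection_reflection, hr, N.adj_adj]
    | cast i =>
      refine ⟨i :: d, ?_, ?_, ?_⟩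
      · intro j hj
        rcases List.mem_cons.1 hj with rfl | hj
        · exact Or.inr List.mem_cons_self
        · exact (hd j hj).imp_right (List.mem_cons_of_mem _)
      · rw [extAdj_castSucc, hcd, act_cons]
      · rw [act_cons]
        induction i using Fin.lastCases with
        | last => rw [hat2_adj_last]; exact hr
        | cast i =>
          rw [hat2_adj_castSucc]
          change (N.reflection hN φ).1 (N.adj i _) = N.adj 0 (N.adj i _)
          -- The reflection commutes with every colour and `r_0` with those from 2 on, so their
          -- agreement persists.
          rw [(N.reflection hN φ).2, hr, N.adj_comm]
          right
          simp only [Fin.val_castSucc] at hi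
          simp only [Fin.val_zero]
          omega

end Tracking

/-! ### Voltages as words -/

open scoped Classical in
/-- The identity for the white vertex, and the 0-adjacency for a black one. -/
def gauge (M : Premaniplex (n + 1)) {X : Type} (w v : X) (Φ : M.V) : M.V :=
  if v = w then Φ else M.adj 0 Φ

theorem gauge_gauge (M : Premaniplex (n + 1)) {X : Type} (w v : X) (Φ : M.V) :
    M.gauge w v (M.gauge w v Φ) = Φ := by
  unfold gauge
  split_ifs
  · rfl
  · exact M.adj_adj _ _

theorem r_unop (M : Premaniplex n) (i : Fin n) (Φ : M.V) : (M.r i).unop Φ = M.adj i Φ := rfl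

section Voltage

variable (N : Premaniplex (n + 1)) (hN : N.Regular) (S : Set N.Facet) (φ : N.V)
  (X : Premaniplex (n + 3)) (w : X.V)

/-- The factors `r_0` in the definition of `ξ` are exactly a change of gauge at the ends of the
dart. For the greatest colour this needs that `ρ̃_0` commutes with `r_0`. -/
theorem xi_unop_gauge (hw : ∀ u v, u ≠ w → v ≠ w → u = v) (h0 : ∀ v, X.adj 0 v ≠ v)
    (hn : ∀ v, X.adj (Fin.last (n + 2)) v ≠ v) (v : X.V) (i : Fin (n + 3)) (p : N.hat2.V) :
    (N.xi hN S φ X w v i).unop (N.hat2.gauge w (X.adj i v) p) =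
      N.hat2.gauge w v (N.extAdj hN S φ i p) := by
  have hlink : ∀ i, X.adj i v ≠ v → (X.adj i v = w ↔ v ≠ w) := by
    intro i hi
    refine ⟨fun h hv => hi (h.trans hv.symm), fun hv => ?_⟩
    by_contra h
    exact hi (hw _ _ h hv)
  induction i using Fin.lastCases with
  | last =>
    rw [xi, Fin.lastCases_last]
    have hy : ∀ q, (N.y hN S φ).unop q =
        N.hat2.adj 0 (N.extAdj hN S φ (Fin.last (n + 2)) q) := by
      intro q
      rw [extAdj, Fin.lastCases_last]
      rfl
    have h := hlink _ (hn v)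
    rw [hy]
    by_cases hv : v = w
    · rw [gauge, gauge, if_pos hv, if_neg (fun h' => h.1 h' hv), extAdj_last_adj_zero,
        N.hat2.adj_adj]
    · rw [gauge, gauge, if_neg hv, if_pos (h.2 hv)]
  | cast j =>
    rw [xi, Fin.lastCases_castSucc, extAdj_castSucc]
    have h := hlink j.castSucc
    by_cases hj : j = 0
    · subst hj
      have h := h (h0 v)
      rw [if_pos rfl]
      change N.hat2.gauge w _ p = _
      by_cases hv : v = w
      · rw [gauge, gauge, if_pos hv, if_neg (fun h' => h.1 h' hv)]
      · rw [gauge, gauge, if_neg hv, if_pos (h.2 hv), N.hat2.adj_adj]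
    · rw [if_neg hj]
      by_cases hs : X.adj j.castSucc v = v
      · rw [if_pos hs, hs]
        by_cases hv : v = w
        · rw [if_pos hv, gauge, gauge, if_pos hv, if_pos hv, r_unop]
        · rw [if_neg hv, gauge, gauge, if_neg hv, if_neg hv]
          simp only [MulOpposite.unop_mul, Equiv.Perm.mul_apply, r_unop, N.hat2.adj_adj]
      · have h := h hs
        rw [if_neg hs]
        by_cases hv : v = w
        · rw [if_pos hv, gauge, gauge, if_pos hv, if_neg (fun h' => h.1 h' hv)]
          simp only [MulOpposite.unop_mul, Equiv.Perm.mul_apply, r_unop, N.hat2.adj_adj]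
        · rw [if_neg hv, gauge, gauge, if_neg hv, if_pos (h.2 hv)]
          simp only [MulOpposite.unop_mul, Equiv.Perm.mul_apply, r_unop]

/-- The gauges at the inner vertices of the path cancel. -/
theorem voltage_unop (hw : ∀ u v, u ≠ w → v ≠ w → u = v) (h0 : ∀ v, X.adj 0 v ≠ v)
    (hn : ∀ v, X.adj (Fin.last (n + 2)) v ≠ v) {a b : X.V} (W : X.Path a b) (p : N.hat2.V) :
    (W.voltage (N.xi hN S φ X w)).unop p =
      N.hat2.gauge w a (N.extAct hN S φ W.colors (N.hat2.gauge w b p)) := by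
  induction W with
  | nil v => exact (N.hat2.gauge_gauge w v p).symm
  | cons v i W ih =>
    rw [Path.voltage, MulOpposite.unop_mul, Equiv.Perm.mul_apply, ih,
      N.xi_unop_gauge hN S φ X w hw h0 hn]
    rfl

end Voltage

/-! ### Paths as words, and the intersection property for words -/

theorem Path.foldl_colors {X : Premaniplex n} {a b : X.V} (W : X.Path a b) :
    W.colors.foldl (fun v i => X.adj i v) a = b := by
  induction W with
  | nil v => rfl
  | cons v i W ih => exact ih

theorem exists_path {X : Premaniplex n} (c : List (Fin n)) {a b : X.V}
    (h : c.foldl (fun v i => X.adj i v) a = b) : ∃ W : X.Path a b, W.colors = c := by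
  induction c generalizing a with
  | nil =>
    obtain rfl : a = b := h
    exact ⟨.nil a, rfl⟩
  | cons i c ih =>
    obtain ⟨W, hW⟩ := ih h
    exact ⟨.cons a i W, by rw [Path.colors, hW]⟩

/-- In a premaniplex with two vertices, the end of a walk depends only on a sum over its colours. -/
theorem exists_colour_parity (X : Premaniplex n) (w : X.V)
    (hw : ∀ u v, u ≠ w → v ≠ w → u = v) :
    ∃ (ε : Fin n → ZMod 2) (q : X.V → ZMod 2), Function.Injective q ∧
      ∀ (c : List (Fin n)) (v : X.V),
        q (c.foldl (fun v i => X.adj i v) v) = q v + (c.map ε).sum := by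
  classical
  let q : X.V → ZMod 2 := fun v => if v = w then 0 else 1
  have hq : Function.Injective q := by
    intro u v h
    by_cases hu : u = w <;> by_cases hv : v = w
    · rw [hu, hv]
    · simp [q, hu, hv] at h
    · simp [q, hu, hv] at h
    · exact hw u v hu hv
  -- On two vertices each colour is the identity or the swap, that is, a translation of `ℤ₂`.
  have hstep : ∀ i v, q (X.adj i v) = q v + q (X.adj i w) := by
    intro i v
    by_cases hv : v = w
    · subst hv; simp [q]
    · by_cases hi : X.adj i w = w
      · have : X.adj i v ≠ w := fun h => hv (by rw [← X.adj_adj i v, h, hi])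
        simp [q, hv, hi, this]
      · have hvi : X.adj i w = v := hw _ _ hi hv
        have : X.adj i v = w := by rw [← hvi, X.adj_adj]
        simp only [q, hv, hi, this, if_true, if_false]
        decide
  refine ⟨fun i => q (X.adj i w), q, hq, fun c => ?_⟩
  induction c with
  | nil => simp
  | cons i c ih => intro v; rw [List.foldl_cons, ih, hstep, List.map_cons, List.sum_cons]; ring

/-- If a word with letters in `[0, m]` and a word with letters in `[k, n]` lead from `a` to `b`
and agree on a set containing a flag of each 0-adjacent pair, then the former agrees with a word
with letters in `[k, m]` that leads from `a` to `b`. -/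
theorem exists_extAct_inter (k₀ : ℕ) {S : Set (M (k₀ + 1)).Facet} (hS : (M (k₀ + 1)).Spread S)
    (φ : (M (k₀ + 1)).V) (X : Premaniplex (k₀ + 5)) (w : X.V)
    (hw : ∀ u v, u ≠ w → v ≠ w → u = v) {k m : ℕ} (hk : 1 < k) (hm : m < k₀ + 4) (a b : X.V)
    (c d : List (Fin (k₀ + 5))) (hc : ∀ i ∈ c, (i : ℕ) ≤ m) (hd : ∀ i ∈ d, k ≤ (i : ℕ))
    (hca : c.foldl (fun v i => X.adj i v) a = b)
    (T : Set (M (k₀ + 1)).hat2.V) (hT : ∀ p, p ∈ T ∨ (M (k₀ + 1)).hat2.adj 0 p ∈ T)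
    (hcd : ∀ p ∈ T, (M (k₀ + 1)).extAct (M_regular _) S φ c p =
      (M (k₀ + 1)).extAct (M_regular _) S φ d p) :
    ∃ e : List (Fin (k₀ + 5)), (∀ i ∈ e, (i : ℕ) ∈ Set.Icc k m) ∧
      e.foldl (fun v i => X.adj i v) a = b ∧
      ∀ p, (M (k₀ + 1)).extAct (M_regular _) S φ e p =
        (M (k₀ + 1)).extAct (M_regular _) S φ c p := by
  have hN : (M (k₀ + 1)).Regular := M_regular _
  have hd2 : ∀ i ∈ d, 2 ≤ (i : ℕ) := fun i hi => hk.trans_le (hd i hi)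
  obtain ⟨c, rfl⟩ := exists_map_castSucc_eq c fun i hi h => by
    have := hc i hi
    rw [h, Fin.val_last] at this
    omega
  have hc' : ∀ i ∈ c, (i : ℕ) ≤ m := fun i hi => hc i.castSucc (List.mem_map_of_mem hi)
  have hcd' : ∀ p ∈ T, (M (k₀ + 1)).hat2.act c p = (M (k₀ + 1)).extAct hN S φ d p := fun p hp => by
    rw [← (M (k₀ + 1)).extAct_map hN S φ]; exact hcd p hp
  obtain ⟨e, he, hec⟩ : ∃ e : List (Fin (k₀ + 4)),
      (∀ i ∈ e, (i : ℕ) ≤ m ∧ (i : ℕ) ∈ {j : ℕ | j = 0 ∨ k ≤ j}) ∧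
      ∀ p, (M (k₀ + 1)).hat2.act c p = (M (k₀ + 1)).hat2.act e p := by
    -- Both flags `(φ, 0)` and `(φ^0, 0)` are on the base edge, and at least one of them is in `T`.
    obtain ⟨p, hpT, hp, hpφ⟩ : ∃ p ∈ T, p.2 = 0 ∧
        ((M (k₀ + 1)).reflection hN φ).1 p.1 = (M (k₀ + 1)).adj 0 p.1 := by
      have hφ := (M (k₀ + 1)).reflection_apply_self hN φ
      rcases hT (φ, 0) with h | h
      · exact ⟨_, h, rfl, hφ⟩
      · have h1 : (M (k₀ + 1)).hat2.adj 0 (φ, 0) = ((M (k₀ + 1)).adj 0 φ, 0) := hat2_adj_zero _ _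
        refine ⟨_, h, congrArg Prod.snd h1, ?_⟩
        have h2 : ((M (k₀ + 1)).hat2.adj 0 (φ, 0)).1 = (M (k₀ + 1)).adj 0 φ := congrArg Prod.fst h1
        rw [h2, ((M (k₀ + 1)).reflection hN φ).2, hφ]
    obtain ⟨d', hd', hdd, -⟩ := exists_extAct_eq_act hS hp hpφ d hd2
    obtain ⟨e, he, hec⟩ := exists_act_inter (k₀ + 2) m {j : ℕ | j = 0 ∨ k ≤ j} (Or.inl rfl) c d'
      hc' (fun i hi => (hd' i hi).imp (fun h => by rw [h]; rfl) fun h => hd _ h) p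
      ((hcd' _ hpT).trans hdd)
    exact ⟨e, he, (M_regular (k₀ + 2)).act_eq hec.symm⟩
  obtain ⟨z, hz, hez⟩ := (M (k₀ + 1)).hat2.exists_act_eq_of_ne_one e fun i hi h => by
    have := (he i hi).2
    simp only [Set.mem_ofPred_eq] at this
    omega
  have hzk : ∀ i ∈ z, (i : ℕ) ∈ Set.Icc k m := fun i hi =>
    ⟨(he i (hz i hi).1).2.resolve_left fun h => (hz i hi).2 (Fin.ext h), (he i (hz i hi).1).1⟩
  rcases hez with hez | hez
  · have hcz : ∀ p, (M (k₀ + 1)).hat2.act z p = (M (k₀ + 1)).hat2.act c p := fun p => by rw [hec, hez]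
    refine ⟨z.map Fin.castSucc, ?_, ?_, fun p => ?_⟩
    · intro i hi
      obtain ⟨j, hj, rfl⟩ := List.mem_map.1 hi
      exact hzk j hj
    -- The colour parities that determine the end of a walk in `X` come from a potential on the
    -- flags, so they are the same for `z` and `c`.
    · obtain ⟨ε, q, hq, hqc⟩ := X.exists_colour_parity w hw
      obtain ⟨p, hp⟩ := exists_potential (k₀ + 2) fun i => ε i.castSucc
      have h1 := potential_act hp z (φ, 0)
      have h2 := potential_act hp c (φ, 0)
      have h3 : (M (k₀ + 2)).act z (φ, 0) = (M (k₀ + 2)).act c (φ, 0) := hcz _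
      rw [h3, h2] at h1
      apply hq
      rw [← hca, hqc, hqc, List.map_map, List.map_map]
      exact congrArg _ (add_left_cancel h1).symm
    · rw [extAct_map, extAct_map, hcz]
  · exfalso
    -- The common image of `p` lies on the vertex of `p^0`, since `z` fixes vertices, and by `Near`
    -- on the vertex of `p` or its mirror image.
    have key : ∀ p ∈ T, p.2 = 0 →
        (toSquare (k₀ + 1) ((M (k₀ + 1)).adj 0 p.1)).1 = (toSquare (k₀ + 1) p.1).1 ∨
        (toSquare (k₀ + 1) ((M (k₀ + 1)).adj 0 p.1)).1 =
          (toSquare (k₀ + 1) (((M (k₀ + 1)).reflection hN φ).1 p.1)).1 := by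
      intro p hpT hp
      have hnear := (near_self (hN := hN) (φ := φ) hp).extAct hS d hd2
      rw [← hcd' _ hpT, hec, hez, hat2_adj_zero] at hnear
      obtain ⟨z', hz', hzz⟩ := (M (k₀ + 1)).exists_hat2_act_fst z
      have hz2 : ∀ i ∈ z', 2 ≤ (i : ℕ) := fun i hi => hk.trans_le (hzk _ (hz' i hi)).1
      have hv : (M (k₀ + 1)).face 0 ((M (k₀ + 1)).adj 0 ((M (k₀ + 1)).hat2.act z p).1) =
          (M (k₀ + 1)).face 0 ((M (k₀ + 1)).adj 0 p.1) := by
        rw [hzz, adj_zero_act _ _ hz2]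
        refine (M (k₀ + 1)).face_zero_act z' (fun i hi h => ?_) _
        have := hz2 i hi
        rw [h] at this
        simp at this
      exact hnear.vertex.imp (fun h => toSquare_fst_eq _ (hv.symm.trans h))
        fun h => toSquare_fst_eq _ (hv.symm.trans h)
    -- Let the square be `ABCD`, with `φ` at `A` on the edge `AB`. From `φ^1` the image is at `D`,
    -- not at `A` or its mirror image `B`. From the 0-neighbour of `φ^1` it is at `A`, not at `D` or
    -- its mirror image `C`.
    have hsq : ∀ s, (squareAdj 0 (squareAdj 1 s)).1 ≠ (squareAdj 1 s).1 ∧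
        (squareAdj 0 (squareAdj 1 s)).1 ≠ (squareAdj 1 (squareAdj 0 s)).1 ∧
        (squareAdj 1 s).1 ≠ (squareAdj 0 (squareAdj 1 s)).1 ∧
        (squareAdj 1 s).1 ≠ (squareAdj 0 (squareAdj 1 (squareAdj 0 s))).1 := by decide
    obtain ⟨s1, s2, s3, s4⟩ := hsq (toSquare (k₀ + 1) φ)
    have hrefl : ((M (k₀ + 1)).reflection hN φ).1 ((M (k₀ + 1)).adj 1 φ) =
        (M (k₀ + 1)).adj 1 ((M (k₀ + 1)).adj 0 φ) := by
      rw [((M (k₀ + 1)).reflection hN φ).2, (M (k₀ + 1)).reflection_apply_self hN φ]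
    rcases hT ((M (k₀ + 1)).adj 1 φ, 0) with h | h
    · have := key _ h rfl
      rw [hrefl] at this
      simp only [toSquare_adj_zero, toSquare_adj_one] at this
      exact this.elim s1 s2
    · have h1 : (M (k₀ + 1)).hat2.adj 0 ((M (k₀ + 1)).adj 1 φ, 0) =
          ((M (k₀ + 1)).adj 0 ((M (k₀ + 1)).adj 1 φ), 0) := hat2_adj_zero _ _
      have h2 : ((M (k₀ + 1)).hat2.adj 0 ((M (k₀ + 1)).adj 1 φ, 0)).1 =
          (M (k₀ + 1)).adj 0 ((M (k₀ + 1)).adj 1 φ) := congrArg Prod.fst h1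
      have := key _ h (congrArg Prod.snd h1)
      rw [h2, ((M (k₀ + 1)).reflection hN φ).2 0, hrefl, (M (k₀ + 1)).adj_adj] at this
      simp only [toSquare_adj_zero, toSquare_adj_one] at this
      exact this.elim s3 s4

theorem voltages_mono (N : Premaniplex (n + 1)) (hN : N.Regular) (S : Set N.Facet) (φ : N.V)
    (X : Premaniplex (n + 3)) (w a b : X.V) {I J : Set ℕ} (h : I ⊆ J) :
    N.voltages hN S φ X w a b I ⊆ N.voltages hN S φ X w a b J :=
  Set.image_mono fun _ hW c hc => h (hW c hc)

end Premaniplex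

end TwoOrbit

end

/-! ### The theorem, for all flags and for the white flags -/

open TwoOrbit.Premaniplex in
theorem theorem5p4 (k₀ : ℕ)
    (S₃ : Set (TwoOrbit.Premaniplex.M 1).Facet) (hS₃ : TwoOrbit.Premaniplex.IsInitialSet S₃)
    (φ : (TwoOrbit.Premaniplex.M (k₀ + 1)).V)
    (X : TwoOrbit.Premaniplex (k₀ + 5)) (hX : Nat.card X.V = 2)
    (h0 : ∀ v, X.adj 0 v ≠ v) (hn : ∀ v, X.adj (Fin.last (k₀ + 4)) v ≠ v)
    (w : X.V) (k m : ℕ) (hk : 1 < k) (hm : m ≤ k₀ + 4) (a b : X.V) :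
    let N := TwoOrbit.Premaniplex.M (k₀ + 1)
    let vol : Set ℕ → Set (TwoOrbit.Premaniplex.RPerm N.hat2.V) :=
      N.voltages (TwoOrbit.Premaniplex.M_regular (k₀ + 1)) (TwoOrbit.Premaniplex.S S₃ k₀) φ X w a b
    vol (Set.Icc 0 m) ∩ vol (Set.Icc k (k₀ + 4)) = vol (Set.Icc k m) ∧
    ∀ p : N.hat2.V → X.V, N.hat2.IsCovering X p →
      N.hat2.restrict {Φ | p Φ = w} '' vol (Set.Icc 0 m) ∩
          N.hat2.restrict {Φ | p Φ = w} '' vol (Set.Icc k (k₀ + 4)) =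
        N.hat2.restrict {Φ | p Φ = w} '' vol (Set.Icc k m) := by
  intro N vol
  have hw : ∀ u v, u ≠ w → v ≠ w → u = v := by
    intro u v hu hv
    by_contra huv
    have hfin : Finite X.V := X.finite
    have h3 : ({u, v, w} : Set X.V).ncard = 3 := by
      rw [Set.ncard_eq_three]
      exact ⟨u, v, w, huv, hu, hv, rfl⟩
    have := Set.ncard_le_card ({u, v, w} : Set X.V)
    omega
  have hmono : ∀ {I J : Set ℕ}, I ⊆ J → vol I ⊆ vol J := fun h => voltages_mono _ _ _ _ _ _ _ _ h
  have hsub₁ : vol (Set.Icc k m) ⊆ vol (Set.Icc 0 m) := hmono (Set.Icc_subset_Icc_left k.zero_le)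
  have hsub₂ : vol (Set.Icc k m) ⊆ vol (Set.Icc k (k₀ + 4)) := hmono (Set.Icc_subset_Icc_right hm)
  have main : ∀ T : Set N.hat2.V, (∀ p, p ∈ T ∨ N.hat2.adj 0 p ∈ T) →
      ∀ f ∈ vol (Set.Icc 0 m), ∀ g ∈ vol (Set.Icc k (k₀ + 4)),
      (∀ p ∈ T, f.unop p = g.unop p) → ∃ h ∈ vol (Set.Icc k m), ∀ p ∈ T, h.unop p = f.unop p := by
    intro T hT f hf g hg hfg
    -- For `m = n` the sets `[k, n]` and `[k, m]` coincide. Otherwise the first path avoids the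
    -- colour `n`.
    rcases hm.eq_or_lt with rfl | hm
    · exact ⟨g, hg, fun p hp => (hfg p hp).symm⟩
    obtain ⟨U, hU, rfl⟩ := hf
    obtain ⟨W, hW, rfl⟩ := hg
    obtain ⟨e, hek, hea, hec⟩ := exists_extAct_inter k₀ (spread_S hS₃ k₀) φ X w hw hk hm a b
      U.colors W.colors (fun i hi => (hU i hi).2) (fun i hi => (hW i hi).1) U.foldl_colors
      -- The gauge at `b` is the identity or `r_0`, so the preimage of `T` still meets every
      -- 0-adjacent pair.
      {p | N.hat2.gauge w b p ∈ T}
      (by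
        intro p
        change N.hat2.gauge w b p ∈ T ∨ N.hat2.gauge w b (N.hat2.adj 0 p) ∈ T
        unfold TwoOrbit.Premaniplex.gauge
        split_ifs
        · exact hT p
        · exact hT _)
      (by
        intro p hp
        have := hfg _ hp
        rw [voltage_unop _ _ _ _ _ _ hw h0 hn, voltage_unop _ _ _ _ _ _ hw h0 hn,
          gauge_gauge] at this
        have := congrArg (N.hat2.gauge w a) this
        rwa [gauge_gauge, gauge_gauge] at this)
    obtain ⟨V, hV⟩ := exists_path e hea
    refine ⟨_, ⟨V, fun i hi => hek i (hV ▸ hi), rfl⟩, fun p _ => ?_⟩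
    rw [voltage_unop _ _ _ _ _ _ hw h0 hn, voltage_unop _ _ _ _ _ _ hw h0 hn, hV, hec]
  refine ⟨Set.Subset.antisymm ?_ (Set.subset_inter hsub₁ hsub₂), fun p hp => ?_⟩
  · rintro f ⟨hf, hg⟩
    obtain ⟨h, hh, hfh⟩ := main Set.univ (fun p => Or.inl trivial) f hf f hg fun _ _ => rfl
    have : h = f := MulOpposite.unop_injective (Equiv.ext fun p => hfh p trivial)
    rwa [← this]
  · refine Set.Subset.antisymm ?_
      (Set.subset_inter (Set.image_mono hsub₁) (Set.image_mono hsub₂))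
    rintro _ ⟨⟨f, hf, rfl⟩, ⟨g, hg, hgf⟩⟩
    -- Since the colour 0 is a link in `X`, 0-adjacent flags have different images under `p`, so one
    -- of them is white.
    obtain ⟨h, hh, hfh⟩ := main {Φ | p Φ = w} (fun Φ => by
      by_contra hcon
      rw [not_or] at hcon
      have h1 : p (N.hat2.adj 0 Φ) = X.adj 0 (p Φ) := hp 0 Φ
      exact h0 (p Φ) (h1 ▸ hw _ _ hcon.2 hcon.1)) f hf g hg
      fun Φ hΦ => (congrFun hgf ⟨Φ, hΦ⟩).symm
    exact ⟨h, hh, funext fun Φ => hfh Φ.1 Φ.2⟩
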